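/- Let $|m\rangle$, $m=0,1,2,\dots$, be the Fock basis of one bosonic mode (the Hilbert space $\ell^2(\mathbb N)$), with $a^\dagger|m\rangle=\sqrt{m+1}\,|m+1\rangle$ and $a|m\rangle=\sqrt m\,|m-1\rangle$, and let $D(\alpha)=\exp(\alpha a^\dagger-\alpha^* a)$ be the displacement operator. For $\beta\in\mathbb C$ let $A(\beta)$ be the sensing matrix of excitation counting after the displacement $D(-\beta)$, i.e. $$A_{n,(m_1,m_2)}(\beta)=\operatorname{tr}\bigl[\,|n\rangle\langle n|\,D(-\beta)\,|m_1\rangle\langle m_2|\,D(-\beta)^\dagger\bigr],\qquad n,m_1,m_2\in\mathbb N ,$$ and let $C(\beta)=A(\beta)^\dagger A(\beta)$ be its covariance matrix, with entries $$C_{m_1m_2,m_3m_4}(\beta)=\sum_{n=0}^{\infty}A_{n,(m_1,m_2)}(\beta)^*\,A_{n,(m_3,m_4)}(\beta).$$ **Theorem (parity selection rule).** There is a nowhere vanishing complex-valued function $g(m_1,m_2,m_3,m_4,\phi)$ of $m_1,m_2,m_3,m_4\in\mathbb N$ and $\phi\in\mathbb R$ such that, for all $m_1,m_2,m_3,m_4\in\mathbb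 N$, as $|\beta|\to\infty$ in $\mathbb C$, with $\phi=\arg\beta$, $$C_{m_1m_2,m_3m_4}(\beta)\sim\begin{cases} g(m_1,m_2,m_3,m_4,\phi)/|\beta|, & m_1+m_2+m_3+m_4 \text{ even},\\[2pt] g(m_1,m_2,m_3,m_4,\phi)/|\beta|^2, & m_1+m_2+m_3+m_4\text{ odd}.\end{cases}$$ Here $u\sim v$ means $u-v=o(v)$ as $|\beta|\to\infty$ (uniformly in $\arg\beta$). -/

import Mathlib

open scoped Asymptotics

noncomputable section

namespace FockTomography

/-- The state space of one bosonic mode, `ℓ²(ℕ)`; the index is the excitation number. -/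
abbrev FockSpace : Type := lp (fun _ : ℕ => ℂ) 2

/-- The Fock state `|m⟩`, with exactly `m` excitations. -/
def fock (m : ℕ) : FockSpace := lp.single 2 m (1 : ℂ)

/-- The dense subspace of finite linear combinations of Fock states, the common invariant domain
of the ladder operators, is modelled by `ℕ →₀ ℂ`; this is its inclusion into `FockSpace`. -/
def embed : (ℕ →₀ ℂ) →ₗ[ℂ] FockSpace := Finsupp.linearCombination ℂ fock

/-- The creation operator: `a†|m⟩ = √(m+1) |m+1⟩`. -/
def creation : Module.End ℂ (ℕ →₀ ℂ) :=
  Finsupp.linearCombination ℂ fun m => Finsupp.single (m + 1) ((Real.sqrt (m + 1) : ℝ) : ℂ)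

/-- The annihilation operator: `a|m⟩ = √m |m-1⟩`, in particular `a|0⟩ = 0`. -/
def annihilation : Module.End ℂ (ℕ →₀ ℂ) :=
  Finsupp.linearCombination ℂ fun m => Finsupp.single (m - 1) ((Real.sqrt m : ℝ) : ℂ)

/-- The skew-symmetric operator `α a† - α* a`. -/
def generator (α : ℂ) : Module.End ℂ (ℕ →₀ ℂ) :=
  α • creation - (starRingEnd ℂ α) • annihilation

/-- The displacement operator `D(α) = exp(α a† - α* a)` on finite linear combinations of Fock
states. These are entire analytic vectors of the generator, so that the exponential series
converges in norm on each of them. -/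
def displacement (α : ℂ) : (ℕ →₀ ℂ) →ₗ[ℂ] FockSpace :=
  Finsupp.linearCombination ℂ fun m =>
    ∑' k : ℕ, ((k.factorial : ℂ))⁻¹ • embed ((generator α ^ k) (Finsupp.single m 1))

/-- The displaced Fock state `D(α)|m⟩`. -/
def displacedFock (α : ℂ) (m : ℕ) : FockSpace := displacement α (Finsupp.single m 1)

/-- The operator `|u⟩⟨v|`. -/
def ketBra (u v : FockSpace) : FockSpace →L[ℂ] FockSpace := InnerProductSpace.rankOne ℂ u v

/-- The trace `∑ₖ ⟨k|T|k⟩` of a (trace class) operator. -/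
def trace (T : FockSpace →L[ℂ] FockSpace) : ℂ := ∑' k : ℕ, inner ℂ (fock k) (T (fock k))

/-- The sensing matrix of excitation counting after the displacement `D(-β)`. Rows are indexed by
the number `n` of counted excitations, columns by the pairs `(m₁, m₂)`, for `|m₁⟩⟨m₂|`:
`A_{n,(m₁,m₂)} = tr[ |n⟩⟨n| D(-β) |m₁⟩⟨m₂| D(-β)† ]`. -/
def sensingMatrix (β : ℂ) : Matrix ℕ (ℕ × ℕ) ℂ := fun n p =>
  trace (ketBra (fock n) (fock n) ∘L ketBra (displacedFock (-β) p.1) (displacedFock (-β) p.2))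

/-- The covariance matrix `C(β) = A(β)† A(β)`; the sum runs over all excitation numbers `n`. -/
def covarianceMatrix (β : ℂ) : Matrix (ℕ × ℕ) (ℕ × ℕ) ℂ := fun p q =>
  ∑' n : ℕ, starRingEnd ℂ (sensingMatrix β n p) * sensingMatrix β n q

end FockTomography

end

namespace FockTomography

open Finsupp Filter Topology Polynomial MeasureTheory

/-! ### Ladder operators on finite linear combinations of Fock states -/

/-! Write `F_ab(w) = ∑ₙ ⟨n|D|a⟩ ⟨n|D|b⟩* wⁿ` with `D = D(-β)`. An entry of `C(β)` is a sum over `n`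
of products of coefficients of `F_{m₂m₁}` and `F_{m₃m₄}`, so Parseval turns it into `(2π)⁻¹ ∫
F_{m₂m₁}(e^{iθ}) F_{m₃m₄}(e^{-iθ}) dθ` (`covarianceMatrix_eq_tsum`). The commutation relations of
`D` with `a` and `a†` give a recursion for `F_ab`. It is solved by an exponential times a phase
times a monic integer polynomial in `y = 2|β| sin(θ/2)` of degree `a + b`
(`sqrt_factorial_mul_overlapSeries`). In the product the exponentials combine to `e^{-y²}`, and the
entry factors exactly into a phase depending on `arg β` and an integral depending on `|β|`
(`covarianceMatrix_eq_angularIntegral`). That integral has integrand `e^{-y²} P(y) e^{iDθ/2}`, with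
`D = m₁+m₂-m₃-m₄` and `P` monic of degree `m₁+m₂+m₃+m₄` and of the same parity.

Laplace's method, with `θ = x/|β|`, gives `|β|⁻¹ ∫ e^{-x²} P(x) dx` to leading order. If `P` is odd,
the part without the phase vanishes exactly, and the first-order term `iDθ/2` of the phase gives
`|β|⁻² (iD/2) ∫ e^{-x²} x P(x) dx`.

It remains to see that these constants are nonzero. `D` is odd in the second case, and a Gaussian
mean of a monic integer polynomial of even degree cannot vanish, by a congruence modulo 2
(`integral_exp_neg_sq_mul_aeval_ne_zero`). -/

lemma creation_single (m : ℕ) (c : ℂ) :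
    creation (single m c) = single (m + 1) (c * ((Real.sqrt (m + 1) : ℝ) : ℂ)) := by
  simp [creation]

lemma annihilation_single (m : ℕ) (c : ℂ) :
    annihilation (single m c) = single (m - 1) (c * ((Real.sqrt m : ℝ) : ℂ)) := by
  simp [annihilation]

lemma creation_apply_zero (u : ℕ →₀ ℂ) : creation u 0 = 0 := by
  induction u using Finsupp.induction_linear with
  | zero => simp
  | add f g hf hg => simp [hf, hg]
  | single m c => simp [creation_single]

lemma creation_apply_succ (u : ℕ →₀ ℂ) (n : ℕ) :
    creation u (n + 1) = ((Real.sqrt (n + 1) : ℝ) : ℂ) * u n := by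
  induction u using Finsupp.induction_linear with
  | zero => simp
  | add f g hf hg => simp [hf, hg, mul_add]
  | single m c =>
    by_cases h : m = n
    · subst h; simp [creation_single, mul_comm]
    · simp [creation_single, h]

lemma annihilation_apply (u : ℕ →₀ ℂ) (n : ℕ) :
    annihilation u n = ((Real.sqrt (n + 1) : ℝ) : ℂ) * u (n + 1) := by
  induction u using Finsupp.induction_linear with
  | zero => simp
  | add f g hf hg => simp [hf, hg, mul_add]
  | single m c =>
    rcases m with _ | m
    · simp [annihilation_single]
    · by_cases h : m = n
      · subst h; simp [annihilation_single, mul_comm]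
      · simp [annihilation_single, h]

lemma annihilation_mul_creation :
    annihilation * creation = creation * annihilation + 1 := by
  refine LinearMap.ext fun u => Finsupp.ext fun n => ?_
  have sq (x : ℕ) : ((Real.sqrt (x + 1) : ℝ) : ℂ) * ((Real.sqrt (x + 1) : ℝ) : ℂ) = x + 1 := by
    rw [← Complex.ofReal_mul, Real.mul_self_sqrt (by positivity)]; push_cast; rfl
  simp only [Module.End.mul_apply, LinearMap.add_apply, Module.End.one_apply, Finsupp.add_apply,
    annihilation_apply, creation_apply_succ]
  rw [← mul_assoc, sq]
  rcases n with _ | n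
  · simp [creation_apply_zero]
  · rw [creation_apply_succ, annihilation_apply, ← mul_assoc, sq]; push_cast; ring

lemma annihilation_creation (u : ℕ →₀ ℂ) :
    annihilation (creation u) = creation (annihilation u) + u :=
  LinearMap.congr_fun annihilation_mul_creation u

lemma generator_apply (α : ℂ) (u : ℕ →₀ ℂ) :
    generator α u = α • creation u - starRingEnd ℂ α • annihilation u := rfl

lemma generator_pow_succ_apply (α : ℂ) (k : ℕ) (u : ℕ →₀ ℂ) :
    (generator α ^ (k + 1)) u = generator α ((generator α ^ k) u) := by
  rw [pow_succ', Module.End.mul_apply]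

/-- The commutator of the generator `G` with `a†` is the scalar `-α*`, so commuting past `G ^ k`
acts like differentiation in `G`. The truncated `k - 1` is harmless at `k = 0`, where its
coefficient is zero. -/
lemma generator_pow_creation (α : ℂ) (k : ℕ) (u : ℕ →₀ ℂ) :
    (generator α ^ k) (creation u) = creation ((generator α ^ k) u)
      - ((k : ℂ) * starRingEnd ℂ α) • (generator α ^ (k - 1)) u := by
  have base (v : ℕ →₀ ℂ) :
      generator α (creation v) = creation (generator α v) - starRingEnd ℂ α • v := by
    simp only [generator_apply, annihilation_creation, map_sub, map_smul]
    module
  induction k with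
  | zero => simp
  | succ k ih =>
    rw [generator_pow_succ_apply, ih, map_sub, base, map_smul, ← generator_pow_succ_apply]
    rcases k with _ | k
    · simp
    · simp only [Nat.add_sub_cancel, ← generator_pow_succ_apply]
      push_cast
      module

lemma annihilation_generator_pow (α : ℂ) (k : ℕ) (u : ℕ →₀ ℂ) :
    annihilation ((generator α ^ k) u) = (generator α ^ k) (annihilation u)
      + ((k : ℂ) * α) • (generator α ^ (k - 1)) u := by
  have base (v : ℕ →₀ ℂ) :
      annihilation (generator α v) = generator α (annihilation v) + α • v := by
    simp only [generator_apply, annihilation_creation, map_sub, map_smul]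
    module
  induction k with
  | zero => simp
  | succ k ih =>
    rw [generator_pow_succ_apply, base, ih, map_add, map_smul, ← generator_pow_succ_apply]
    rcases k with _ | k
    · simp
    · simp only [Nat.add_sub_cancel, ← generator_pow_succ_apply]
      push_cast
      module

/-! ### Matrix elements of the displacement operator -/

lemma embed_apply (u : ℕ →₀ ℂ) (n : ℕ) : (embed u : ∀ _ : ℕ, ℂ) n = u n := by
  induction u using Finsupp.induction_linear with
  | zero => simp
  | add f g hf hg => simp [hf, hg]
  | single m c =>
    by_cases h : m = n
    · subst h; simp [embed, fock]
    · simp [embed, fock, h]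

lemma sqrt_mul_sqrt_factorial_le (m k : ℕ) :
    Real.sqrt m * Real.sqrt ((m - 1 + k).factorial / (m - 1).factorial)
      ≤ Real.sqrt ((m + (k + 1)).factorial / m.factorial) := by
  rcases m with _ | m
  · simp
  · rw [← Real.sqrt_mul (by positivity)]
    apply Real.sqrt_le_sqrt
    rw [mul_div_assoc', div_le_div_iff₀ (by positivity) (by positivity)]
    have h1 : ((m + 1 + (k + 1)).factorial : ℝ)
        = (m + k + 2) * ((m + k + 1) * (m + k).factorial) := by
      rw [show m + 1 + (k + 1) = m + k + 1 + 1 by ring, Nat.factorial_succ, Nat.factorial_succ]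
      push_cast; ring
    rw [h1, Nat.factorial_succ, Nat.add_sub_cancel]
    push_cast
    have h2 : ((m : ℝ) + 1) * (m + 1) ≤ (m + k + 2) * (m + k + 1) := by
      have : (0 : ℝ) ≤ k := by positivity
      gcongr <;> linarith
    calc _ = (((m : ℝ) + 1) * (m + 1)) * ((m + k).factorial * m.factorial) := by ring
      _ ≤ ((m + k + 2) * (m + k + 1)) * ((m + k).factorial * m.factorial) := by gcongr
      _ = _ := by ring

/-- Peeling off the rightmost generator sends `|m⟩` to multiples of `|m+1⟩` and `|m-1⟩`. The raising
branch reproduces the bound exactly and the lowering branch is no larger, whence the factor 2 per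
step. -/
lemma norm_embed_generator_pow_le (α : ℂ) (k m : ℕ) :
    ‖embed ((generator α ^ k) (single m 1))‖
      ≤ (2 * ‖α‖) ^ k * Real.sqrt ((m + k).factorial / m.factorial) := by
  induction k generalizing m with
  | zero =>
    have : (m.factorial : ℝ) ≠ 0 := by positivity
    simp [embed, fock, this]
  | succ k ih =>
    have step : (generator α ^ (k + 1)) (single m 1)
        = (α * ((Real.sqrt (m + 1) : ℝ) : ℂ)) • (generator α ^ k) (single (m + 1) 1)
          - (starRingEnd ℂ α * ((Real.sqrt m : ℝ) : ℂ)) •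
              (generator α ^ k) (single (m - 1) 1) := by
      rw [pow_succ, Module.End.mul_apply, ← map_smul, ← map_smul, ← map_sub]
      congr 1
      simp [generator, creation_single, annihilation_single]
    rw [step, map_sub, map_smul, map_smul]
    refine (norm_sub_le _ _).trans ?_
    rw [norm_smul, norm_smul, norm_mul, norm_mul, RCLike.norm_conj, Complex.norm_real,
      Complex.norm_real, Real.norm_of_nonneg (Real.sqrt_nonneg _),
      Real.norm_of_nonneg (Real.sqrt_nonneg _)]
    have h1 : Real.sqrt (m + 1) * Real.sqrt ((m + 1 + k).factorial / (m + 1).factorial)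
        = Real.sqrt ((m + (k + 1)).factorial / m.factorial) := by
      rw [← Real.sqrt_mul (by positivity), show m + 1 + k = m + (k + 1) by ring,
        Nat.factorial_succ m]
      congr 1
      push_cast
      field_simp
    have h2 := sqrt_mul_sqrt_factorial_le m k
    calc _ ≤ ‖α‖ * Real.sqrt (m + 1) *
            ((2 * ‖α‖) ^ k * Real.sqrt ((m + 1 + k).factorial / (m + 1).factorial))
          + ‖α‖ * Real.sqrt m *
            ((2 * ‖α‖) ^ k * Real.sqrt ((m - 1 + k).factorial / (m - 1).factorial)) := by
          gcongr
          · exact ih _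
          · exact ih _
      _ = ‖α‖ * (2 * ‖α‖) ^ k *
            (Real.sqrt (m + 1) * Real.sqrt ((m + 1 + k).factorial / (m + 1).factorial))
          + ‖α‖ * (2 * ‖α‖) ^ k *
            (Real.sqrt m * Real.sqrt ((m - 1 + k).factorial / (m - 1).factorial)) := by ring
      _ ≤ ‖α‖ * (2 * ‖α‖) ^ k * Real.sqrt ((m + (k + 1)).factorial / m.factorial)
          + ‖α‖ * (2 * ‖α‖) ^ k * Real.sqrt ((m + (k + 1)).factorial / m.factorial) := by
          rw [h1]; gcongr
      _ = _ := by ring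

lemma summable_pow_mul_sqrt_factorial_div (c : ℝ) (hc : 0 < c) (m : ℕ) :
    Summable fun k : ℕ =>
      ((k.factorial : ℝ))⁻¹ * (c ^ k * Real.sqrt ((m + k).factorial / m.factorial)) := by
  refine summable_of_ratio_test_tendsto_lt_one (l := 0) one_pos
    (Eventually.of_forall fun k => by positivity) ?_
  have hlim : Tendsto (fun k : ℕ => c * Real.sqrt ((m + 1) * ((k : ℝ) + 1)⁻¹)) atTop (𝓝 0) := by
    have h := tendsto_one_div_add_atTop_nhds_zero_nat (𝕜 := ℝ)
    simp only [one_div] at h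
    have h2 := ((h.const_mul ((m : ℝ) + 1)).sqrt).const_mul c
    simpa using h2
  refine squeeze_zero (fun _ => by positivity) (fun k => ?_) hlim
  rw [Real.norm_of_nonneg (by positivity), Real.norm_of_nonneg (by positivity),
    div_le_iff₀ (by positivity)]
  have h1 : Real.sqrt (((m + (k + 1)).factorial : ℝ) / m.factorial)
      = Real.sqrt (m + k + 1) * Real.sqrt ((m + k).factorial / m.factorial) := by
    rw [← Real.sqrt_mul (by positivity), ← add_assoc, Nat.factorial_succ]
    congr 1
    push_cast
    ring
  -- Squared, this is `m + k + 1 ≤ (m + 1) * (k + 1)`.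
  have h2 : Real.sqrt (m + k + 1) ≤ (k + 1) * Real.sqrt ((m + 1) * ((k : ℝ) + 1)⁻¹) := by
    apply Real.sqrt_le_iff.mpr
    refine ⟨by positivity, ?_⟩
    rw [mul_pow, Real.sq_sqrt (by positivity)]
    field_simp
    nlinarith [mul_nonneg (Nat.cast_nonneg (α := ℝ) m) (Nat.cast_nonneg (α := ℝ) k)]
  rw [h1, Nat.factorial_succ]
  push_cast
  rw [mul_inv, pow_succ]
  have : ((k : ℝ) + 1)⁻¹ * Real.sqrt (m + k + 1) ≤ Real.sqrt ((m + 1) * ((k : ℝ) + 1)⁻¹) := by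
    rw [inv_mul_le_iff₀ (by positivity)]; exact h2
  calc _ = (((k : ℝ) + 1)⁻¹ * Real.sqrt (m + k + 1)) *
        (c * ((k.factorial : ℝ)⁻¹ * (c ^ k * Real.sqrt ((m + k).factorial / m.factorial)))) := by
        ring
    _ ≤ Real.sqrt ((m + 1) * ((k : ℝ) + 1)⁻¹) *
        (c * ((k.factorial : ℝ)⁻¹ * (c ^ k * Real.sqrt ((m + k).factorial / m.factorial)))) := by
        gcongr
    _ = _ := by ring

lemma hasSum_displacedFock (α : ℂ) (m : ℕ) :
    HasSum (fun k : ℕ => ((k.factorial : ℂ))⁻¹ • embed ((generator α ^ k) (single m 1)))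
      (displacedFock α m) := by
  have h : Summable fun k : ℕ =>
      ((k.factorial : ℂ))⁻¹ • embed ((generator α ^ k) (single m 1)) := by
    -- The `+ 1` keeps the ratio-test constant positive when `α = 0`.
    refine Summable.of_norm_bounded
      (summable_pow_mul_sqrt_factorial_div (2 * ‖α‖ + 1) (by positivity) m) fun k => ?_
    rw [norm_smul, norm_inv, Complex.norm_natCast]
    gcongr
    refine (norm_embed_generator_pow_le α k m).trans ?_
    gcongr
    linarith
  have h2 : displacedFock α m
      = ∑' k : ℕ, ((k.factorial : ℂ))⁻¹ • embed ((generator α ^ k) (single m 1)) := by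
    simp [displacedFock, displacement]
  rw [h2]
  exact h.hasSum

/-- The matrix element `⟨n|D(α)|m⟩`. -/
noncomputable def displacementCoeff (α : ℂ) (n m : ℕ) : ℂ :=
  (displacedFock α m : ∀ _ : ℕ, ℂ) n

lemma inner_fock (n : ℕ) (v : FockSpace) : inner ℂ (fock n) v = (v : ∀ _ : ℕ, ℂ) n := by
  simp [fock, lp.inner_single_left]

lemma inner_fock_right (n : ℕ) (v : FockSpace) :
    inner ℂ v (fock n) = starRingEnd ℂ ((v : ∀ _ : ℕ, ℂ) n) := by
  rw [← inner_conj_symm, inner_fock]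

lemma hasSum_displacementCoeff (α : ℂ) (n m : ℕ) :
    HasSum (fun k : ℕ => ((k.factorial : ℂ))⁻¹ * (generator α ^ k) (single m 1) n)
      (displacementCoeff α n m) := by
  have h := (hasSum_displacedFock α m).mapL (innerSL ℂ (fock n))
  simp only [innerSL_apply_apply, inner_smul_right, inner_fock, embed_apply] at h
  exact h

lemma hasSum_complex_congr {f g : ℕ → ℂ} {a b : ℂ} (h : HasSum f a) (hfg : ∀ k, g k = f k)
    (hab : b = a) : HasSum g b := by
  rw [funext hfg, hab]; exact h

/-- Since `k / k! = 1 / (k-1)!`, the commutator terms of the powers resum to the exponential series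
itself. This carries the commutation relations from powers of the generator to `D(α)`. -/
lemma hasSum_shifted_displacementCoeff (α c : ℂ) (n m : ℕ) :
    HasSum (fun k : ℕ => ((k.factorial : ℂ))⁻¹ *
        (k * c * (generator α ^ (k - 1)) (single m 1) n))
      (c * displacementCoeff α n m) := by
  rw [← hasSum_nat_add_iff' 1]
  simp only [Finset.range_one, Finset.sum_singleton, Nat.cast_zero, zero_mul, mul_zero, sub_zero]
  refine hasSum_complex_congr ((hasSum_displacementCoeff α n m).mul_left c) (fun k => ?_) rfl
  have : (k : ℂ) + 1 ≠ 0 := Nat.cast_add_one_ne_zero k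
  rw [Nat.factorial_succ, Nat.add_sub_cancel]
  push_cast
  field_simp

lemma hasSum_creation_single (α : ℂ) (n m : ℕ) :
    HasSum (fun k : ℕ => ((k.factorial : ℂ))⁻¹ *
        creation ((generator α ^ k) (single m 1)) n)
      (((Real.sqrt n : ℝ) : ℂ) * displacementCoeff α (n - 1) m) := by
  rcases n with _ | n
  · simp [creation_apply_zero]
  · refine hasSum_complex_congr
      ((hasSum_displacementCoeff α n m).mul_left ((Real.sqrt (n + 1) : ℝ) : ℂ)) (fun k => ?_) ?_
    · rw [creation_apply_succ]; ring
    · simp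

/-- `D(α) a† = (a† - α*) D(α)` in matrix elements. -/
lemma sqrt_mul_displacementCoeff_succ_right (α : ℂ) (n m : ℕ) :
    ((Real.sqrt (m + 1) : ℝ) : ℂ) * displacementCoeff α n (m + 1)
      = ((Real.sqrt n : ℝ) : ℂ) * displacementCoeff α (n - 1) m
        - starRingEnd ℂ α * displacementCoeff α n m := by
  have h1 := (hasSum_displacementCoeff α n (m + 1)).mul_left ((Real.sqrt (m + 1) : ℝ) : ℂ)
  have h2 := (hasSum_creation_single α n m).sub
    (hasSum_shifted_displacementCoeff α (starRingEnd ℂ α) n m)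
  refine h1.unique (hasSum_complex_congr h2 (fun k => ?_) rfl)
  have h3 : (single (m + 1) ((Real.sqrt (m + 1) : ℝ) : ℂ) : ℕ →₀ ℂ) = creation (single m 1) := by
    simp [creation_single]
  have h4 : ((Real.sqrt (m + 1) : ℝ) : ℂ) * (generator α ^ k) (single (m + 1) 1) n
      = (generator α ^ k) (creation (single m 1)) n := by
    rw [← h3, ← smul_eq_mul, ← Finsupp.smul_apply, ← map_smul, Finsupp.smul_single, smul_eq_mul,
      mul_one]
  rw [mul_left_comm, h4, generator_pow_creation, Finsupp.sub_apply, Finsupp.smul_apply,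
    smul_eq_mul]
  ring

/-- `a D(α) = D(α) (a + α)` in matrix elements. -/
lemma sqrt_mul_displacementCoeff_succ_left (α : ℂ) (n m : ℕ) :
    ((Real.sqrt (n + 1) : ℝ) : ℂ) * displacementCoeff α (n + 1) m
      = ((Real.sqrt m : ℝ) : ℂ) * displacementCoeff α n (m - 1)
        + α * displacementCoeff α n m := by
  have h1 := (hasSum_displacementCoeff α (n + 1) m).mul_left ((Real.sqrt (n + 1) : ℝ) : ℂ)
  have h2 := ((hasSum_displacementCoeff α n (m - 1)).mul_left ((Real.sqrt m : ℝ) : ℂ)).add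
    (hasSum_shifted_displacementCoeff α α n m)
  refine h1.unique (hasSum_complex_congr h2 (fun k => ?_) rfl)
  have h4 : ((Real.sqrt m : ℝ) : ℂ) * (generator α ^ k) (single (m - 1) 1) n
      = (generator α ^ k) (annihilation (single m 1)) n := by
    rw [annihilation_single, one_mul, ← smul_eq_mul, ← Finsupp.smul_apply, ← map_smul,
      Finsupp.smul_single, smul_eq_mul, mul_one]
  rw [mul_left_comm, ← annihilation_apply, annihilation_generator_pow, Finsupp.add_apply,
    Finsupp.smul_apply, smul_eq_mul, ← h4]
  ring

/-- The outermost generator contributes only `-α* a` to the vacuum component, and moving `a` to the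
right until it kills `|0⟩` leaves `(k+1) α` times a lower power. -/
lemma generator_pow_add_two_vacuum (α : ℂ) (k : ℕ) :
    (generator α ^ (k + 2)) (single 0 1) 0
      = -((‖α‖ : ℂ) ^ 2) * (k + 1) * (generator α ^ k) (single 0 1) 0 := by
  have h := congrArg (fun u : ℕ →₀ ℂ => u 0)
    (annihilation_generator_pow α (k + 1) (single 0 1))
  simp only [annihilation_single, Finsupp.add_apply, Finsupp.smul_apply, smul_eq_mul] at h
  rw [generator_pow_succ_apply, generator_apply, Finsupp.sub_apply, Finsupp.smul_apply,
    Finsupp.smul_apply, creation_apply_zero, smul_eq_mul, smul_eq_mul, h,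
    ← Complex.mul_conj']
  simp
  ring

lemma generator_pow_vacuum_even (α : ℂ) (l : ℕ) :
    (((2 * l).factorial : ℂ))⁻¹ * (generator α ^ (2 * l)) (single 0 1) 0
      = (l.factorial : ℂ)⁻¹ * (-(‖α‖ : ℂ) ^ 2 / 2) ^ l := by
  induction l with
  | zero => simp
  | succ l ih =>
    have h1 : (l : ℂ) + 1 ≠ 0 := Nat.cast_add_one_ne_zero l
    have h2 : (2 * l : ℂ) + 1 ≠ 0 := by exact_mod_cast Nat.succ_ne_zero (2 * l)
    have h3 : (((2 * (l + 1)).factorial : ℂ))⁻¹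
        = ((2 * l : ℂ) + 1)⁻¹ * (2 * (l + 1) : ℂ)⁻¹ * (((2 * l).factorial : ℂ))⁻¹ := by
      rw [show 2 * (l + 1) = 2 * l + 1 + 1 by ring, Nat.factorial_succ, Nat.factorial_succ]
      push_cast
      rw [← mul_inv, ← mul_inv]
      congr 1
      ring
    rw [h3, show 2 * (l + 1) = 2 * l + 2 by ring, generator_pow_add_two_vacuum, pow_succ,
      Nat.factorial_succ]
    push_cast
    calc _ = (-(‖α‖ : ℂ) ^ 2) * (2 * (l + 1) : ℂ)⁻¹ * (((2 * l : ℂ) + 1)⁻¹ * (2 * l + 1)) *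
          ((((2 * l).factorial : ℂ))⁻¹ * (generator α ^ (2 * l)) (single 0 1) 0) := by ring
      _ = _ := by
        rw [ih, inv_mul_cancel₀ h2, mul_inv, mul_inv]
        ring

lemma generator_pow_vacuum_odd (α : ℂ) (l : ℕ) :
    (generator α ^ (2 * l + 1)) (single 0 1) 0 = 0 := by
  induction l with
  | zero => simp [generator_apply, creation_single, annihilation_single]
  | succ l ih =>
    rw [show 2 * (l + 1) + 1 = 2 * l + 1 + 2 by ring, generator_pow_add_two_vacuum, ih, mul_zero]

lemma displacementCoeff_zero_zero (α : ℂ) :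
    displacementCoeff α 0 0 = Complex.exp (-(‖α‖ : ℂ) ^ 2 / 2) := by
  have he : HasSum (fun l : ℕ => (((2 * l).factorial : ℂ))⁻¹ *
      (generator α ^ (2 * l)) (single 0 1) 0) (Complex.exp (-(‖α‖ : ℂ) ^ 2 / 2)) := by
    rw [Complex.exp_eq_exp_ℂ]
    exact hasSum_complex_congr (NormedSpace.exp_series_hasSum_exp' (𝕂 := ℂ) _)
      (fun l => by rw [generator_pow_vacuum_even, smul_eq_mul]) rfl
  have ho : HasSum (fun l : ℕ => (((2 * l + 1).factorial : ℂ))⁻¹ *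
      (generator α ^ (2 * l + 1)) (single 0 1) 0) 0 := by
    exact hasSum_complex_congr hasSum_zero
      (fun l => by rw [generator_pow_vacuum_odd, mul_zero]) rfl
  have h := HasSum.even_add_odd (f := fun k : ℕ => ((k.factorial : ℂ))⁻¹ *
    (generator α ^ k) (single 0 1) 0) he ho
  rw [add_zero] at h
  exact (hasSum_displacementCoeff α 0 0).unique h

/-! ### The sensing matrix -/

lemma sensingMatrix_eq (β : ℂ) (n a b : ℕ) :
    sensingMatrix β n (a, b)
      = displacementCoeff (-β) n a * starRingEnd ℂ (displacementCoeff (-β) n b) := by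
  have h0 : (fock n : ∀ _ : ℕ, ℂ) n = 1 := by simp [fock]
  rw [sensingMatrix, trace, tsum_eq_single n]
  · simp only [ketBra, ContinuousLinearMap.comp_apply, InnerProductSpace.rankOne_apply,
      inner_smul_right, inner_fock, h0, inner_fock_right]
    simp [displacementCoeff, mul_comm]
  · intro k hk
    simp only [ketBra, ContinuousLinearMap.comp_apply, InnerProductSpace.rankOne_apply,
      inner_smul_right, inner_fock]
    simp [fock, hk]

lemma summable_displacementCoeff_mul_conj (α : ℂ) (a b : ℕ) :
    Summable fun n =>
      displacementCoeff α n a * starRingEnd ℂ (displacementCoeff α n b) := by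
  have h := lp.summable_inner (𝕜 := ℂ) (displacedFock α b) (displacedFock α a)
  simpa [displacementCoeff, mul_comm] using h

/-! ### The polynomials of the overlaps of displaced Fock states -/

/-- Integer polynomials `h a b`, of degree `a + b`, in terms of which
`∑ₙ ⟨n|D|a⟩ ⟨n|D|b⟩* wⁿ` is expressed. -/
noncomputable def overlapPoly : ℕ → ℕ → ℤ[X]
  | 0, b => X ^ b
  | a + 1, b => X * overlapPoly a b - (b : ℤ[X]) * overlapPoly a (b - 1)

lemma overlapPoly_succ (a b : ℕ) :
    overlapPoly (a + 1) b = X * overlapPoly a b - (b : ℤ[X]) * overlapPoly a (b - 1) := rfl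

lemma overlapPoly_monic (a b : ℕ) : (overlapPoly a b).IsMonicOfDegree (a + b) := by
  induction a generalizing b with
  | zero => rw [zero_add]; exact isMonicOfDegree_X_pow ℤ b
  | succ a ih =>
    rw [overlapPoly_succ, show a + 1 + b = 1 + (a + b) by ring]
    refine ((isMonicOfDegree_X ℤ).mul (ih b)).sub ?_
    refine (natDegree_mul_le).trans_lt ?_
    rw [natDegree_natCast, (ih (b - 1)).natDegree_eq]
    omega

lemma aeval_neg_overlapPoly (a b : ℕ) (y : ℂ) :
    aeval (-y) (overlapPoly a b) = (-1) ^ (a + b) * aeval y (overlapPoly a b) := by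
  induction a generalizing b with
  | zero => simp [overlapPoly, neg_pow y]
  | succ a ih =>
    simp only [overlapPoly_succ, map_sub, map_mul, aeval_X, ih, map_natCast]
    rcases b with _ | b
    · simp; ring
    · simp only [Nat.add_sub_cancel]; ring

/-! ### Generating functions of the rows of the sensing matrix -/

/-- `∑ₙ ⟨n|D(α)|a⟩ ⟨n|D(α)|b⟩* wⁿ`, the matrix element of `D(α)† w^{a† a} D(α)`. -/
noncomputable def overlapSeries (α w : ℂ) (a b : ℕ) : ℂ :=
  ∑' n, displacementCoeff α n a * starRingEnd ℂ (displacementCoeff α n b) * w ^ n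

lemma hasSum_overlapSeries (α : ℂ) {w : ℂ} (hw : ‖w‖ = 1) (a b : ℕ) :
    HasSum (fun n => displacementCoeff α n a * starRingEnd ℂ (displacementCoeff α n b) * w ^ n)
      (overlapSeries α w a b) := by
  refine Summable.hasSum (Summable.of_norm_bounded
    (summable_displacementCoeff_mul_conj α a b).norm fun n => ?_)
  rw [norm_mul _ (w ^ n), norm_pow, hw, one_pow, mul_one]

lemma conj_overlapSeries (α w : ℂ) (a b : ℕ) :
    starRingEnd ℂ (overlapSeries α (starRingEnd ℂ w) a b) = overlapSeries α w b a := by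
  simp only [overlapSeries, Complex.conj_tsum, map_mul, map_pow, Complex.conj_conj]
  exact tsum_congr fun n => by ring

/-- The relation for `D(α) a†` lowers `n` in the first factor. After the shift of `n`, the conjugate
of the relation for `a D(α)` restores a common index in both factors, at the price of a factor `w`.
-/
lemma sqrt_mul_overlapSeries_succ_left (α : ℂ) {w : ℂ} (hw : ‖w‖ = 1) (a b : ℕ) :
    ((Real.sqrt (a + 1) : ℝ) : ℂ) * overlapSeries α w (a + 1) b
      = w * ((Real.sqrt b : ℝ) : ℂ) * overlapSeries α w a (b - 1)
        + starRingEnd ℂ α * (w - 1) * overlapSeries α w a b := by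
  have h1 := (hasSum_overlapSeries α hw (a + 1) b).mul_left ((Real.sqrt (a + 1) : ℝ) : ℂ)
  have h2 : HasSum (fun n : ℕ => ((Real.sqrt n : ℝ) : ℂ) * displacementCoeff α (n - 1) a
        * starRingEnd ℂ (displacementCoeff α n b) * w ^ n)
      (w * ((Real.sqrt b : ℝ) : ℂ) * overlapSeries α w a (b - 1)
        + w * starRingEnd ℂ α * overlapSeries α w a b) := by
    rw [← hasSum_nat_add_iff' 1]
    refine hasSum_complex_congr
      (((hasSum_overlapSeries α hw a (b - 1)).mul_left (w * ((Real.sqrt b : ℝ) : ℂ))).add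
        ((hasSum_overlapSeries α hw a b).mul_left (w * starRingEnd ℂ α))) (fun n => ?_) ?_
    · have h := congrArg (starRingEnd ℂ) (sqrt_mul_displacementCoeff_succ_left α n b)
      simp only [map_mul, map_add, Complex.conj_ofReal] at h
      rw [Nat.add_sub_cancel, Nat.cast_add, Nat.cast_one, mul_right_comm _ (displacementCoeff α n a),
        h]
      ring
    · simp
  refine h1.unique (hasSum_complex_congr
    (h2.sub ((hasSum_overlapSeries α hw a b).mul_left (starRingEnd ℂ α))) (fun n => ?_) ?_)
  · rw [← mul_assoc, ← mul_assoc, sqrt_mul_displacementCoeff_succ_right]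
    ring
  · ring

lemma sqrt_mul_overlapSeries_zero_succ (α : ℂ) {w : ℂ} (hw : ‖w‖ = 1) (b : ℕ) :
    ((Real.sqrt (b + 1) : ℝ) : ℂ) * overlapSeries α w 0 (b + 1)
      = α * (w - 1) * overlapSeries α w 0 b := by
  have h := congrArg (starRingEnd ℂ) (sqrt_mul_overlapSeries_succ_left α
    (w := starRingEnd ℂ w) (by rw [RCLike.norm_conj, hw]) b 0)
  simpa [conj_overlapSeries] using h

lemma displacementCoeff_zero_right (α : ℂ) (n : ℕ) :
    ((Real.sqrt n.factorial : ℝ) : ℂ) * displacementCoeff α n 0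
      = α ^ n * Complex.exp (-(‖α‖ : ℂ) ^ 2 / 2) := by
  induction n with
  | zero => simp [displacementCoeff_zero_zero]
  | succ n ih =>
    have h := sqrt_mul_displacementCoeff_succ_left α n 0
    simp only [Nat.cast_zero, Real.sqrt_zero, Complex.ofReal_zero, zero_mul, zero_add] at h
    rw [Nat.factorial_succ, Nat.cast_mul, Real.sqrt_mul (by positivity), Nat.cast_add, Nat.cast_one,
      Complex.ofReal_mul, pow_succ]
    linear_combination ((Real.sqrt n.factorial : ℝ) : ℂ) * h + α * ih

/-- The counts in a coherent state are Poisson distributed with mean `‖α‖²`; this is their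
generating function. -/
lemma overlapSeries_zero_zero (α : ℂ) {w : ℂ} (hw : ‖w‖ = 1) :
    overlapSeries α w 0 0 = Complex.exp ((‖α‖ : ℂ) ^ 2 * (w - 1)) := by
  have h1 : HasSum (fun n : ℕ => (n.factorial : ℂ)⁻¹ * ((‖α‖ : ℂ) ^ 2 * w) ^ n)
      (Complex.exp ((‖α‖ : ℂ) ^ 2 * w)) := by
    rw [Complex.exp_eq_exp_ℂ]
    exact hasSum_complex_congr (NormedSpace.exp_series_hasSum_exp' (𝕂 := ℂ) _)
      (fun l => by rw [smul_eq_mul]) rfl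
  have h2 := h1.mul_left (Complex.exp (-(‖α‖ : ℂ) ^ 2))
  rw [← Complex.exp_add] at h2
  refine (hasSum_overlapSeries α hw 0 0).unique (hasSum_complex_congr h2 (fun n => ?_) ?_)
  · have h := displacementCoeff_zero_right α n
    have hc := congrArg (starRingEnd ℂ) h
    simp only [map_mul, Complex.conj_ofReal, map_pow, ← Complex.exp_conj] at hc
    have h3 := congrArg₂ (· * ·) h hc
    have h4 : starRingEnd ℂ (-(‖α‖ : ℂ) ^ 2 / 2) = -(‖α‖ : ℂ) ^ 2 / 2 := by
      rw [show -(‖α‖ : ℂ) ^ 2 / 2 = ((-‖α‖ ^ 2 / 2 : ℝ) : ℂ) by push_cast; rfl,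
        Complex.conj_ofReal]
    have h5 : ((Real.sqrt n.factorial : ℝ) : ℂ) * ((Real.sqrt n.factorial : ℝ) : ℂ)
        = n.factorial := by
      rw [← Complex.ofReal_mul, Real.mul_self_sqrt (by positivity)]; simp
    have h6 : Complex.exp (-(‖α‖ : ℂ) ^ 2 / 2) * Complex.exp (-(‖α‖ : ℂ) ^ 2 / 2)
        = Complex.exp (-(‖α‖ : ℂ) ^ 2) := by
      rw [← Complex.exp_add]; congr 1; ring
    simp only [h4] at h3
    have h7 : (n.factorial : ℂ) * (displacementCoeff α n 0 *
          starRingEnd ℂ (displacementCoeff α n 0))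
        = ((‖α‖ : ℂ) ^ 2) ^ n * Complex.exp (-(‖α‖ : ℂ) ^ 2) := by
      have h9 : ((‖α‖ : ℂ) ^ 2) ^ n = α ^ n * starRingEnd ℂ α ^ n := by
        rw [← Complex.mul_conj', mul_pow]
      rw [← h5, ← h6, h9]
      linear_combination h3
    have h8 : (n.factorial : ℂ) ≠ 0 := Nat.cast_ne_zero.mpr n.factorial_ne_zero
    rw [mul_pow]
    field_simp
    linear_combination w ^ n * h7
  · congr 1; ring

/-- Once `η ^ a * η' ^ b` and the factorials are split off, `η * η' = -w` turns the coefficient `w *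
b` of the recursion into `-b`, which is the recursion defining `overlapPoly`. -/
lemma sqrt_factorial_mul_overlapSeries (α : ℂ) {w : ℂ} (hw : ‖w‖ = 1) {η η' y : ℂ}
    (hη : starRingEnd ℂ α * (w - 1) = η * y) (hη' : α * (w - 1) = η' * y) (h : η * η' = -w)
    (a b : ℕ) :
    ((Real.sqrt a.factorial : ℝ) : ℂ) * ((Real.sqrt b.factorial : ℝ) : ℂ)
        * overlapSeries α w a b
      = Complex.exp ((‖α‖ : ℂ) ^ 2 * (w - 1)) * η ^ a * η' ^ b
        * aeval y (overlapPoly a b) := by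
  have hs (n : ℕ) : ((Real.sqrt (n + 1).factorial : ℝ) : ℂ)
      = ((Real.sqrt n.factorial : ℝ) : ℂ) * ((Real.sqrt (n + 1) : ℝ) : ℂ) := by
    rw [Nat.factorial_succ, Nat.cast_mul, Real.sqrt_mul (by positivity), Complex.ofReal_mul,
      Nat.cast_add, Nat.cast_one, mul_comm]
  have h0 := overlapSeries_zero_zero α hw
  generalize Complex.exp ((‖α‖ : ℂ) ^ 2 * (w - 1)) = E at h0 ⊢
  induction a generalizing b with
  | zero =>
    induction b with
    | zero => simp [h0, overlapPoly]
    | succ b ih =>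
      have h1 := sqrt_mul_overlapSeries_zero_succ α hw b
      rw [hη'] at h1
      simp only [overlapPoly, map_pow, aeval_X, Nat.factorial_zero] at ih ⊢
      rw [hs]
      simp only [pow_succ]
      linear_combination η' * y * ih
        + ((Real.sqrt ((1 : ℕ) : ℝ) : ℝ) : ℂ) * ((Real.sqrt b.factorial : ℝ) : ℂ) * h1
  | succ a ih =>
    have h1 := sqrt_mul_overlapSeries_succ_left α hw a b
    rw [hη] at h1
    simp only [overlapPoly_succ, map_sub, map_mul, aeval_X, map_natCast]
    rw [hs a]
    rcases b with _ | b
    · have h2 := ih 0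
      simp only [Nat.cast_zero, Real.sqrt_zero, Complex.ofReal_zero] at h1 ⊢
      linear_combination η * y * h2
        + ((Real.sqrt a.factorial : ℝ) : ℂ) * ((Real.sqrt (Nat.factorial 0) : ℝ) : ℂ) * h1
    · have h2 := ih (b + 1)
      have h3 := ih b
      have h4 : ((Real.sqrt ((b + 1 : ℕ) : ℝ) : ℝ) : ℂ) * ((Real.sqrt ((b + 1 : ℕ) : ℝ) : ℝ) : ℂ)
          = b + 1 := by
        rw [← Complex.ofReal_mul, Real.mul_self_sqrt (by positivity)]; push_cast; rfl
      have h5 := hs b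
      rw [h5] at h2 ⊢
      simp only [Nat.add_sub_cancel, Nat.cast_add, Nat.cast_one] at h1 h4 ⊢
      linear_combination ((Real.sqrt a.factorial : ℝ) : ℂ) * ((Real.sqrt b.factorial : ℝ) : ℂ)
          * ((Real.sqrt (b + 1) : ℝ) : ℂ) * h1 + η * y * h2 + w * (b + 1) * h3
        + w * ((Real.sqrt a.factorial : ℝ) : ℂ) * ((Real.sqrt b.factorial : ℝ) : ℂ)
          * overlapSeries α w a b * h4
        + E * η ^ a * η' ^ b * (b + 1) * aeval y (overlapPoly a b) * h

/-! ### Parseval's identity on the circle -/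

lemma integral_exp_pow_mul_exp_neg_pow (n k : ℕ) :
    ∫ θ in (-Real.pi)..Real.pi, Complex.exp (θ * Complex.I) ^ n
        * Complex.exp (-θ * Complex.I) ^ k = if n = k then (2 * Real.pi : ℂ) else 0 := by
  have h (θ : ℝ) : Complex.exp (θ * Complex.I) ^ n * Complex.exp (-θ * Complex.I) ^ k
      = Complex.exp (((n : ℂ) - k) * Complex.I * θ) := by
    rw [← Complex.exp_nat_mul, ← Complex.exp_nat_mul, ← Complex.exp_add]
    congr 1; ring
  simp only [h]
  split_ifs with hnk
  · subst hnk
    simp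
    ring
  · have hc : ((n : ℂ) - k) * Complex.I ≠ 0 :=
      mul_ne_zero (sub_ne_zero.mpr (by exact_mod_cast hnk)) Complex.I_ne_zero
    rw [integral_exp_mul_complex hc, div_eq_zero_iff, sub_eq_zero]
    left
    rw [Complex.exp_eq_exp_iff_exists_int]
    exact ⟨(n : ℤ) - k, by push_cast; ring⟩

/-- Absolute summability of the double series allows termwise integration, and orthogonality of the
characters leaves the diagonal. -/
lemma integral_tsum_mul_tsum {x y : ℕ → ℂ} (hx : Summable x) (hy : Summable y) :
    ∫ θ in (-Real.pi)..Real.pi, (∑' n, x n * Complex.exp (θ * Complex.I) ^ n)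
        * (∑' n, y n * Complex.exp (-θ * Complex.I) ^ n)
      = 2 * Real.pi * ∑' n, x n * y n := by
  let f : ℕ × ℕ → C(ℝ, ℂ) := fun p =>
    ⟨fun θ => (x p.1 * Complex.exp (θ * Complex.I) ^ p.1)
      * (y p.2 * Complex.exp (-θ * Complex.I) ^ p.2), by fun_prop⟩
  have hn1 (θ : ℝ) : ‖Complex.exp (θ * Complex.I)‖ = 1 := Complex.norm_exp_ofReal_mul_I θ
  have hn2 (θ : ℝ) : ‖Complex.exp (-θ * Complex.I)‖ = 1 := by
    simpa using Complex.norm_exp_ofReal_mul_I (-θ)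
  have hsum : Summable fun p : ℕ × ℕ => ‖x p.1‖ * ‖y p.2‖ :=
    hx.norm.mul_of_nonneg hy.norm (fun _ => norm_nonneg _) (fun _ => norm_nonneg _)
  have hf : Summable fun p => ‖(f p).restrict
      (⟨Set.uIcc (-Real.pi) Real.pi, isCompact_uIcc⟩ : TopologicalSpace.Compacts ℝ)‖ := by
    refine Summable.of_nonneg_of_le (fun _ => norm_nonneg _) (fun p => ?_) hsum
    rw [ContinuousMap.norm_le _ (by positivity)]
    intro θ
    simp only [f, ContinuousMap.restrict_apply, ContinuousMap.coe_mk, norm_mul, norm_pow, hn1, hn2,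
      one_pow, mul_one, le_refl]
  have h := intervalIntegral.hasSum_intervalIntegral_of_summable_norm hf
  have h1 (θ : ℝ) : ∑' p, f p θ = (∑' n, x n * Complex.exp (θ * Complex.I) ^ n)
      * (∑' n, y n * Complex.exp (-θ * Complex.I) ^ n) := by
    rw [tsum_mul_tsum_of_summable_norm]
    · rfl
    · simpa only [norm_mul, norm_pow, hn1, one_pow, mul_one] using hx.norm
    · simpa only [norm_mul, norm_pow, hn2, one_pow, mul_one] using hy.norm
  have h2 (p : ℕ × ℕ) : ∫ θ in (-Real.pi)..Real.pi, f p θ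
      = if p.1 = p.2 then 2 * Real.pi * (x p.1 * y p.1) else 0 := by
    have h3 (θ : ℝ) : f p θ = (x p.1 * y p.2) * (Complex.exp (θ * Complex.I) ^ p.1
        * Complex.exp (-θ * Complex.I) ^ p.2) := by
      simp only [f, ContinuousMap.coe_mk]; ring
    simp only [h3]
    rw [intervalIntegral.integral_const_mul, integral_exp_pow_mul_exp_neg_pow]
    split_ifs with hp
    · rw [hp]; ring
    · simp
  simp only [h1, h2] at h
  rw [← h.tsum_eq, ← tsum_mul_left, ← Function.Injective.tsum_eq (g := fun n : ℕ => (n, n))]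
  · simp
  · intro a b hab; simpa using hab
  · rintro ⟨a, b⟩ hab
    simp only [Function.mem_support, ne_eq, ite_eq_right_iff, Classical.not_imp] at hab
    exact ⟨a, by simp [hab.1]⟩

/-! ### Gaussian moments -/

lemma integrable_exp_neg_mul_sq_mul_pow {b : ℝ} (hb : 0 < b) (k : ℕ) :
    Integrable fun x : ℝ => Real.exp (-b * x ^ 2) * x ^ k := by
  have h := integrable_rpow_mul_exp_neg_mul_sq hb (s := k)
    (by have : (0 : ℝ) ≤ k := k.cast_nonneg
        linarith)
  simpa only [Real.rpow_natCast, mul_comm] using h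

lemma integral_exp_neg_sq_mul_pow_odd {k : ℕ} (hk : Odd k) :
    ∫ x : ℝ, Real.exp (-x ^ 2) * x ^ k = 0 := by
  have h := integral_neg_eq_self (fun x : ℝ => Real.exp (-x ^ 2) * x ^ k) volume
  simp only [neg_sq, hk.neg_pow, mul_neg, integral_neg] at h
  linarith

/-- Twice the half-line integral is `Γ(k + 1/2)`. For `k = 0` the truncated `2 * k - 1` is `0`, and
`0‼ = 1` is the correct value. -/
lemma integral_exp_neg_sq_mul_pow_even (k : ℕ) :
    ∫ x : ℝ, Real.exp (-x ^ 2) * x ^ (2 * k)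
      = Real.sqrt Real.pi * (2 * k - 1).doubleFactorial / 2 ^ k := by
  have h1 := integral_comp_abs (f := fun x : ℝ => Real.exp (-x ^ 2) * x ^ (2 * k))
  simp only [pow_mul, sq_abs] at h1
  simp only [pow_mul]
  rw [h1]
  have h2 := integral_rpow_mul_exp_neg_mul_rpow (p := 2) (q := 2 * k) (b := 1) two_pos
    (by have : (0 : ℝ) ≤ k := k.cast_nonneg
        linarith) one_pos
  rw [Real.one_rpow, show ((2 * k + 1) / 2 : ℝ) = k + 1 / 2 by ring, Real.Gamma_nat_add_half] at h2
  have h3 : ∫ x in Set.Ioi (0 : ℝ), Real.exp (-x ^ 2) * (x ^ 2) ^ k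
      = ∫ x in Set.Ioi (0 : ℝ), x ^ (2 * k : ℝ) * Real.exp (-1 * x ^ (2 : ℝ)) := by
    refine setIntegral_congr_fun measurableSet_Ioi fun x _ => ?_
    have h4 : x ^ (2 * k : ℝ) = (x ^ 2) ^ k := by
      rw [← pow_mul, ← Real.rpow_natCast]; push_cast; rfl
    simp only [h4, Real.rpow_two, neg_one_mul]
    rw [mul_comm]
  rw [h3, h2]
  ring

lemma odd_doubleFactorial (k : ℕ) : Odd (2 * k - 1).doubleFactorial := by
  induction k with
  | zero => simp
  | succ k ih =>
    rcases k with _ | k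
    · simp
    · rw [show 2 * (k + 1 + 1) - 1 = (2 * (k + 1) - 1) + 2 by omega, Nat.doubleFactorial_add_two]
      exact Odd.mul ⟨k + 1, by omega⟩ ih

/-- The Gaussian mean of a monic integer polynomial of even degree `2 M` is a nonzero multiple of
an odd integer: modulo two only the top moment `(2 M - 1)‼` contributes. -/
lemma integral_exp_neg_sq_mul_aeval_ne_zero {P : ℤ[X]} {M : ℕ} (hP : P.IsMonicOfDegree (2 * M)) :
    ∫ x : ℝ, Real.exp (-x ^ 2) * aeval x P ≠ 0 := by
  -- Scaled by `2 ^ M / √π`, the moment of order `2 * j` becomes `2 ^ (M - j) * (2 * j - 1)‼`: even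
  -- for `j < M`, odd for `j = M`.
  have hmom (k : ℕ) (hk : k < 2 * M) : ∃ z : ℤ, Even z ∧
      2 ^ M * ∫ x : ℝ, Real.exp (-x ^ 2) * x ^ k = Real.sqrt Real.pi * z := by
    rcases Nat.even_or_odd' k with ⟨j, rfl | rfl⟩
    · refine ⟨2 ^ (M - j) * (2 * j - 1).doubleFactorial, ?_, ?_⟩
      · exact ((even_two).pow_of_ne_zero (by omega)).mul_right _
      · rw [integral_exp_neg_sq_mul_pow_even]
        have : (2 : ℝ) ^ M = 2 ^ (M - j) * 2 ^ j := by
          rw [← pow_add]; congr 1; omega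
        rw [this]
        push_cast
        field_simp
    · exact ⟨0, Even.zero, by rw [integral_exp_neg_sq_mul_pow_odd ⟨j, rfl⟩]; simp⟩
  choose! z hz hmom using hmom
  have hsum : 2 ^ M * ∫ x : ℝ, Real.exp (-x ^ 2) * aeval x P = Real.sqrt Real.pi *
      ((∑ k ∈ Finset.range (2 * M), P.coeff k * z k + (2 * M - 1).doubleFactorial : ℤ) : ℝ) := by
    have h1 (x : ℝ) : Real.exp (-x ^ 2) * aeval x P
        = ∑ k ∈ Finset.range (2 * M + 1), (P.coeff k : ℝ) * (Real.exp (-x ^ 2) * x ^ k) := by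
      rw [aeval_eq_sum_range, hP.natDegree_eq, Finset.mul_sum]
      exact Finset.sum_congr rfl fun k _ => by rw [zsmul_eq_mul]; ring
    simp only [h1]
    rw [integral_finsetSum _ fun k _ => by
        simpa using (integrable_exp_neg_mul_sq_mul_pow one_pos k).const_mul (P.coeff k : ℝ),
      Finset.sum_range_succ]
    have h2 : P.coeff (2 * M) = 1 := by
      have := hP.leadingCoeff_eq
      rwa [leadingCoeff, hP.natDegree_eq] at this
    simp only [integral_const_mul]
    rw [h2, integral_exp_neg_sq_mul_pow_even, mul_add, Finset.mul_sum]
    push_cast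
    rw [mul_add, Finset.mul_sum]
    congr 1
    · refine Finset.sum_congr rfl fun k hk => ?_
      rw [mul_left_comm, hmom k (Finset.mem_range.mp hk)]
      ring
    · field_simp
  intro h0
  rw [h0, mul_zero, eq_comm, mul_eq_zero] at hsum
  have hodd : Odd (∑ k ∈ Finset.range (2 * M), P.coeff k * z k
      + ((2 * M - 1).doubleFactorial : ℤ)) := by
    refine Even.add_odd (Finset.even_sum _ fun k hk => ?_)
      (by exact_mod_cast odd_doubleFactorial M)
    exact (hz k (Finset.mem_range.mp hk)).mul_left _
  rcases hsum with h | h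
  · exact (Real.sqrt_pos.mpr Real.pi_pos).ne' h
  · rw [Int.cast_eq_zero] at h
    rw [h] at hodd
    exact absurd hodd (by decide)

/-! ### Laplace's method for the angular integral -/

/-- Jordan's inequality `sin t ≥ 2t/π` on `[0, π/2]`. It supplies a Gaussian majorant independent of
`r`. -/
lemma sq_mul_le_sq_two_mul_sin {r x : ℝ} (hr : 0 < r) (hx : |x| ≤ Real.pi * r) :
    4 / Real.pi ^ 2 * x ^ 2 ≤ (2 * r * Real.sin (x / r / 2)) ^ 2 := by
  have hpi := Real.pi_pos
  have h1 : 2 / Real.pi * (|x| / r / 2) ≤ Real.sin (|x| / r / 2) := by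
    refine Real.mul_le_sin (by positivity) ?_
    have : |x| / r ≤ Real.pi := by rwa [div_le_iff₀ hr]
    linarith
  have h2 : 0 ≤ 2 / Real.pi * (|x| / r / 2) := by positivity
  have h3 : Real.sin (|x| / r / 2) ^ 2 = Real.sin (x / r / 2) ^ 2 := by
    rcases abs_choice x with h | h <;> rw [h]
    rw [neg_div, neg_div, Real.sin_neg, neg_sq]
  have h4 := pow_le_pow_left₀ h2 h1 2
  rw [h3] at h4
  calc 4 / Real.pi ^ 2 * x ^ 2 = (2 * r) ^ 2 * (2 / Real.pi * (|x| / r / 2)) ^ 2 := by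
        rw [mul_pow (2 / Real.pi), div_pow (|x| / r), div_pow |x|, sq_abs]
        field_simp
        ring
    _ ≤ (2 * r) ^ 2 * Real.sin (x / r / 2) ^ 2 := by gcongr
    _ = _ := by ring

lemma abs_two_mul_sin_le {r : ℝ} (hr : 0 < r) (x : ℝ) :
    |2 * r * Real.sin (x / r / 2)| ≤ |x| := by
  rw [abs_mul, abs_of_pos (by positivity : 0 < 2 * r)]
  calc 2 * r * |Real.sin (x / r / 2)| ≤ 2 * r * |x / r / 2| := by
        exact mul_le_mul_of_nonneg_left Real.abs_sin_le_abs (by positivity)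
    _ = |x| := by
        rw [abs_div, abs_div, abs_of_pos hr, abs_two]
        field_simp

lemma tendsto_two_mul_sin (x : ℝ) :
    Tendsto (fun r : ℝ => 2 * r * Real.sin (x / r / 2)) atTop (𝓝 x) := by
  have h1 : Tendsto (fun r : ℝ => x * Real.sinc (x / r / 2)) atTop (𝓝 x) := by
    have h2 : Tendsto (fun r : ℝ => x / r / 2) atTop (𝓝 0) := by
      simpa using (tendsto_id.const_div_atTop x).div_const (2 : ℝ)
    have h3 := ((Real.continuous_sinc.tendsto 0).comp h2).const_mul x
    simpa using h3
  refine h1.congr' ?_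
  filter_upwards [eventually_gt_atTop 0] with r hr
  rcases eq_or_ne x 0 with rfl | hx
  · simp
  · rw [Real.sinc_of_ne_zero (by positivity)]
    field_simp

lemma abs_aeval_le (P : ℤ[X]) {x y : ℝ} (h : |y| ≤ |x|) :
    |aeval y P| ≤ ∑ k ∈ Finset.range (P.natDegree + 1), |(P.coeff k : ℝ)| * |x| ^ k := by
  rw [aeval_eq_sum_range]
  refine (Finset.abs_sum_le_sum_abs _ _).trans (Finset.sum_le_sum fun k _ => ?_)
  rw [zsmul_eq_mul, abs_mul, abs_pow]
  gcongr

/-- Substitute `θ = x / r` and apply dominated convergence. The factor `K` may depend on `r` and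
grow linearly in `r * |θ|`, so that both the phase itself (even case) and `r` times the phase minus
one (odd case) are covered. -/
lemma tendsto_mul_integral_exp_neg_sin_sq (P : ℤ[X]) {K : ℝ → ℝ → ℂ} {k : ℝ → ℂ} {c : ℝ}
    (hKc : ∀ r, Continuous (K r)) (hKb : ∀ r > 0, ∀ θ, ‖K r θ‖ ≤ c * (1 + r * |θ|))
    (hKk : ∀ x, Tendsto (fun r => K r (x / r)) atTop (𝓝 (k x))) :
    Tendsto (fun r : ℝ => (r : ℂ) * ∫ θ in (-Real.pi)..Real.pi,
        ((Real.exp (-(2 * r * Real.sin (θ / 2)) ^ 2)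
          * aeval (2 * r * Real.sin (θ / 2)) P : ℝ) : ℂ) * K r θ) atTop
      (𝓝 (∫ x : ℝ, ((Real.exp (-x ^ 2) * aeval x P : ℝ) : ℂ) * k x)) := by
  have hpi := Real.pi_pos
  have hPc : Continuous fun y : ℝ => aeval y P := P.continuous_aeval
  let G : ℝ → ℝ → ℂ := fun r θ => ((Real.exp (-(2 * r * Real.sin (θ / 2)) ^ 2)
    * aeval (2 * r * Real.sin (θ / 2)) P : ℝ) : ℂ) * K r θ
  have hGc (r : ℝ) : Continuous (G r) := by
    refine Continuous.mul (Complex.continuous_ofReal.comp (Continuous.mul (by fun_prop) ?_)) (hKc r)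
    exact hPc.comp (by fun_prop)
  let F : ℝ → ℝ → ℂ := fun r =>
    (Set.Ioc (-Real.pi * r) (Real.pi * r)).indicator fun x => G r (x / r)
  let bound : ℝ → ℝ := fun x => Real.exp (-(4 / Real.pi ^ 2) * x ^ 2)
    * (∑ k ∈ Finset.range (P.natDegree + 1), |(P.coeff k : ℝ)| * |x| ^ k) * (c * (1 + |x|))
  have hF : ∀ᶠ r : ℝ in atTop, ∫ x, F r x = (r : ℂ) * ∫ θ in (-Real.pi)..Real.pi, G r θ := by
    filter_upwards [eventually_gt_atTop 0] with r hr
    have h := intervalIntegral.integral_comp_div (a := -Real.pi * r) (b := Real.pi * r) (G r) hr.ne'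
    rw [mul_div_cancel_right₀ _ hr.ne', mul_div_cancel_right₀ _ hr.ne', Complex.real_smul] at h
    rw [← h, integral_indicator measurableSet_Ioc, intervalIntegral.integral_of_le]
    nlinarith
  refine Tendsto.congr' hF (tendsto_integral_filter_of_dominated_convergence bound ?_ ?_ ?_ ?_)
  · exact Eventually.of_forall fun r =>
      ((hGc r).comp (continuous_id.div_const r)).aestronglyMeasurable.indicator measurableSet_Ioc
  · filter_upwards [eventually_gt_atTop 0] with r hr
    refine Eventually.of_forall fun x => ?_
    -- The sign of `c` is forced by the bound on `K` at `r = 1`.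
    have hb (x : ℝ) : 0 ≤ c * (1 + |x|) := by
      have := (norm_nonneg _).trans (hKb 1 one_pos x)
      simpa using this
    by_cases hx : x ∈ Set.Ioc (-Real.pi * r) (Real.pi * r)
    · have hx' : |x| ≤ Real.pi * r := abs_le.mpr ⟨by linarith [hx.1], hx.2⟩
      simp only [F, Set.indicator_of_mem hx, G, bound]
      rw [norm_mul, Complex.norm_real, Real.norm_eq_abs, abs_mul, Real.abs_exp]
      have h1 := abs_aeval_le P (abs_two_mul_sin_le hr x)
      have h2 := hKb r hr (x / r)
      rw [abs_div, abs_of_pos hr, mul_div_cancel₀ _ hr.ne'] at h2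
      have h3 := sq_mul_le_sq_two_mul_sin hr hx'
      gcongr
      linarith
    · simp only [F, Set.indicator_of_notMem hx, norm_zero, bound]
      have := hb x
      positivity
  · have h (k : ℕ) : Integrable fun x : ℝ =>
        Real.exp (-(4 / Real.pi ^ 2) * x ^ 2) * |x| ^ k := by
      have := (integrable_exp_neg_mul_sq_mul_pow (b := 4 / Real.pi ^ 2) (by positivity) k).norm
      simpa only [norm_mul, norm_pow, Real.norm_eq_abs, Real.abs_exp] using this
    have hb : bound = fun x => ∑ k ∈ Finset.range (P.natDegree + 1),
        |(P.coeff k : ℝ)| * c * (Real.exp (-(4 / Real.pi ^ 2) * x ^ 2) * |x| ^ k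
          + Real.exp (-(4 / Real.pi ^ 2) * x ^ 2) * |x| ^ (k + 1)) := by
      funext x
      simp only [bound, Finset.mul_sum, Finset.sum_mul]
      exact Finset.sum_congr rfl fun k _ => by ring
    rw [hb]
    exact integrable_finsetSum _ fun k _ => ((h k).add (h (k + 1))).const_mul _
  · refine Eventually.of_forall fun x => ?_
    have hy := tendsto_two_mul_sin x
    have h1 : Tendsto (fun r : ℝ => G r (x / r)) atTop
        (𝓝 (((Real.exp (-x ^ 2) * aeval x P : ℝ) : ℂ) * k x)) := by
      refine Tendsto.mul ((Complex.continuous_ofReal.tendsto _).comp (Tendsto.mul ?_ ?_)) (hKk x)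
      · exact (Real.continuous_exp.tendsto _).comp (hy.pow 2).neg
      · exact (hPc.tendsto x).comp hy
    refine h1.congr' ?_
    filter_upwards [eventually_gt_atTop |x|, eventually_gt_atTop 0] with r hr hr0
    have h3 : |x| < Real.pi * r := by nlinarith [Real.pi_gt_three]
    rw [abs_lt] at h3
    simp only [F]
    have hx : x ∈ Set.Ioc (-Real.pi * r) (Real.pi * r) := ⟨by linarith [h3.1], h3.2.le⟩
    rw [Set.indicator_of_mem hx]

/-- The angular integral which gives the entries of the covariance matrix. -/
noncomputable def angularIntegral (P : ℤ[X]) (D r : ℝ) : ℂ :=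
  ∫ θ in (-Real.pi)..Real.pi, ((Real.exp (-(2 * r * Real.sin (θ / 2)) ^ 2)
    * aeval (2 * r * Real.sin (θ / 2)) P : ℝ) : ℂ)
      * Complex.exp (Complex.I * ((D * θ / 2 : ℝ) : ℂ))

lemma tendsto_mul_angularIntegral (P : ℤ[X]) (D : ℝ) :
    Tendsto (fun r : ℝ => (r : ℂ) * angularIntegral P D r) atTop
      (𝓝 ((∫ x : ℝ, Real.exp (-x ^ 2) * aeval x P : ℝ) : ℂ)) := by
  have h := tendsto_mul_integral_exp_neg_sin_sq P
    (K := fun _ θ => Complex.exp (Complex.I * ((D * θ / 2 : ℝ) : ℂ))) (k := fun _ => 1) (c := 1)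
    (fun r => by fun_prop)
    (fun r hr θ => by
      rw [Complex.norm_exp_I_mul_ofReal]
      have : 0 ≤ r * |θ| := by positivity
      linarith)
    (fun x => by
      have h1 : Tendsto (fun r : ℝ => D * (x / r) / 2) atTop (𝓝 0) := by
        simpa using ((tendsto_id.const_div_atTop x).const_mul D).div_const (2 : ℝ)
      have h2 : Continuous fun t : ℝ => Complex.exp (Complex.I * (t : ℂ)) := by fun_prop
      have h3 := (h2.tendsto 0).comp h1
      rw [Complex.ofReal_zero, mul_zero, Complex.exp_zero] at h3
      exact h3)
  simp only [mul_one] at h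
  rwa [integral_complex_ofReal] at h

/-- For odd `P` the integrand without the phase is odd in `θ` for every `r`, so the phase may be
replaced by the phase minus one. The extra power of `r` then turns this difference into a difference
quotient at `0`. -/
lemma tendsto_sq_mul_angularIntegral {P : ℤ[X]} (hP : ∀ y : ℝ, aeval (-y) P = -aeval y P)
    (D : ℝ) :
    Tendsto (fun r : ℝ => (r : ℂ) ^ 2 * angularIntegral P D r) atTop
      (𝓝 (Complex.I * (D / 2 : ℝ) *
        ((∫ x : ℝ, Real.exp (-x ^ 2) * aeval x (X * P) : ℝ) : ℂ))) := by
  have h := tendsto_mul_integral_exp_neg_sin_sq P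
    (K := fun r θ => (r : ℂ) * (Complex.exp (Complex.I * ((D * θ / 2 : ℝ) : ℂ)) - 1))
    (k := fun x => Complex.I * (D / 2 : ℝ) * (x : ℂ)) (c := |D|)
    (fun r => by fun_prop)
    (fun r hr θ => by
      rw [norm_mul, Complex.norm_real, Real.norm_of_nonneg hr.le]
      have h1 := Real.norm_exp_I_mul_ofReal_sub_one_le (x := D * θ / 2)
      rw [Real.norm_eq_abs, abs_div, abs_mul, abs_two] at h1
      have h2 : 0 ≤ |D| * |θ| := by positivity
      calc _ ≤ r * (|D| * |θ| / 2) := by gcongr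
        _ ≤ r * (|D| * |θ|) := by gcongr; linarith
        _ ≤ _ := by nlinarith [abs_nonneg D])
    (fun x => by
      have h1 : HasDerivAt (fun t : ℝ => Complex.exp (Complex.I * ((D * (x * t) / 2 : ℝ) : ℂ)))
          (Complex.I * (D / 2 : ℝ) * (x : ℂ)) 0 := by
        have h2 : HasDerivAt (fun t : ℝ => D * (x * t) / 2) (D * x / 2) 0 := by
          simpa using (((hasDerivAt_id (0 : ℝ)).const_mul x).const_mul D).div_const 2
        have h3 := (h2.ofReal_comp.const_mul Complex.I).cexp
        convert h3 using 1
        simp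
        ring
      -- The slope is taken at `t = 1 / r`, which tends to `0` from the right.
      have h4 := h1.tendsto_slope_zero.comp
        (tendsto_inv_atTop_nhdsGT_zero.mono_right
          (nhdsWithin_mono _ fun t (ht : (0 : ℝ) < t) => ht.ne'))
      refine h4.congr fun r => ?_
      simp [div_eq_mul_inv])
  have hlim : ∫ x : ℝ, ((Real.exp (-x ^ 2) * aeval x P : ℝ) : ℂ) * (Complex.I * (D / 2 : ℝ) * x)
      = Complex.I * (D / 2 : ℝ) *
        ((∫ x : ℝ, Real.exp (-x ^ 2) * aeval x (X * P) : ℝ) : ℂ) := by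
    rw [← integral_complex_ofReal, ← integral_const_mul]
    congr 1
    funext x
    rw [map_mul, aeval_X]
    push_cast
    ring
  rw [hlim] at h
  refine h.congr fun r => ?_
  let u : ℝ → ℂ := fun θ => ((Real.exp (-(2 * r * Real.sin (θ / 2)) ^ 2)
    * aeval (2 * r * Real.sin (θ / 2)) P : ℝ) : ℂ)
  have hu : Continuous u := by
    refine Complex.continuous_ofReal.comp (Continuous.mul (by fun_prop) ?_)
    exact P.continuous_aeval.comp (by fun_prop)
  have hodd : ∫ θ in (-Real.pi)..Real.pi, u θ = 0 := by
    have h5 := intervalIntegral.integral_comp_neg (a := -Real.pi) (b := Real.pi) u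
    have h6 (θ : ℝ) : u (-θ) = -u θ := by
      simp only [u, neg_div, Real.sin_neg, mul_neg, hP, neg_sq, Complex.ofReal_neg]
    simp only [h6, intervalIntegral.integral_neg, neg_neg] at h5
    have h7 : (2 : ℂ) * ∫ θ in (-Real.pi)..Real.pi, u θ = 0 := by linear_combination -h5
    simpa using h7
  have hsub : angularIntegral P D r = ∫ θ in (-Real.pi)..Real.pi,
      u θ * (Complex.exp (Complex.I * ((D * θ / 2 : ℝ) : ℂ)) - 1) := by
    simp only [mul_sub, mul_one]
    rw [intervalIntegral.integral_sub, hodd, sub_zero]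
    · rfl
    · exact (hu.mul (by fun_prop)).intervalIntegrable _ _
    · exact hu.intervalIntegrable _ _
  rw [hsub, sq, mul_assoc]
  congr 1
  rw [← intervalIntegral.integral_const_mul]
  congr 1
  funext θ
  simp only [u]
  ring

/-! ### The covariance matrix as an angular integral -/

lemma exp_mul_I_sub_one (θ : ℝ) :
    Complex.exp (θ * Complex.I) - 1
      = Complex.I * Complex.exp (Complex.I * (θ / 2 : ℝ)) * (2 * Real.sin (θ / 2) : ℝ) := by
  have h1 : Complex.exp (θ * Complex.I)
      = Complex.exp (Complex.I * (θ / 2 : ℝ)) * Complex.exp (Complex.I * (θ / 2 : ℝ)) := by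
    rw [← Complex.exp_add]; congr 1; push_cast; ring
  have h2 : (1 : ℂ)
      = Complex.exp (Complex.I * (θ / 2 : ℝ)) * Complex.exp (-(Complex.I * (θ / 2 : ℝ))) := by
    rw [← Complex.exp_add, add_neg_cancel, Complex.exp_zero]
  have h3 : ((2 * Real.sin (θ / 2) : ℝ) : ℂ) * Complex.I
      = Complex.exp (Complex.I * (θ / 2 : ℝ)) - Complex.exp (-(Complex.I * (θ / 2 : ℝ))) := by
    rw [Complex.ofReal_mul, Complex.ofReal_sin, Complex.sin]
    have : Complex.I * Complex.I = -1 := Complex.I_mul_I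
    rw [neg_mul, mul_comm ((θ / 2 : ℝ) : ℂ)]
    push_cast
    linear_combination (Complex.exp (-(Complex.I * (θ / 2)))
      - Complex.exp (Complex.I * (θ / 2))) * this
  rw [h1]
  linear_combination (-Complex.exp (Complex.I * (θ / 2 : ℝ))) * h3 - h2

lemma aeval_ofReal (P : ℤ[X]) (y : ℝ) : aeval (y : ℂ) P = ((aeval y P : ℝ) : ℂ) :=
  aeval_algebraMap_apply (R := ℤ) (A := ℝ) ℂ y P

lemma sqrt_factorial_mul_overlapSeries_exp (β : ℂ) (θ : ℝ) (a b : ℕ) :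
    ((Real.sqrt a.factorial : ℝ) : ℂ) * ((Real.sqrt b.factorial : ℝ) : ℂ)
        * overlapSeries (-β) (Complex.exp (θ * Complex.I)) a b
      = Complex.exp ((‖β‖ : ℂ) ^ 2 * (Complex.exp (θ * Complex.I) - 1))
        * ((-Complex.I) ^ (a + b)
        * Complex.exp (Complex.I * ((θ / 2 * (a + b) + β.arg * (b - a) : ℝ) : ℂ)))
        * (aeval (2 * ‖β‖ * Real.sin (θ / 2)) (overlapPoly a b) : ℝ) := by
  have hβ : (‖β‖ : ℂ) * Complex.exp (Complex.I * β.arg) = β := by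
    rw [mul_comm Complex.I]; exact Complex.norm_mul_exp_arg_mul_I β
  have hβc : (‖β‖ : ℂ) * Complex.exp (-(Complex.I * β.arg)) = starRingEnd ℂ β := by
    conv_rhs => rw [← hβ]
    rw [map_mul, Complex.conj_ofReal, ← Complex.exp_conj, map_mul, Complex.conj_I,
      Complex.conj_ofReal, neg_mul]
  -- With `w - 1 = 2i e^{iθ/2} sin(θ/2)`, choosing the unimodular `η, η' = -i e^{iθ/2} e^{∓i arg β}`
  -- makes `y` real and gives `η η' = -w`.
  have h := sqrt_factorial_mul_overlapSeries (-β) (Complex.norm_exp_ofReal_mul_I θ)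
    (η := -Complex.I * (Complex.exp (Complex.I * (θ / 2 : ℝ)) *
      Complex.exp (-(Complex.I * β.arg))))
    (η' := -Complex.I * (Complex.exp (Complex.I * (θ / 2 : ℝ)) *
      Complex.exp (Complex.I * β.arg)))
    (y := ((2 * ‖β‖ * Real.sin (θ / 2) : ℝ) : ℂ))
    (by rw [exp_mul_I_sub_one, map_neg, ← hβc]; push_cast; ring)
    (by rw [exp_mul_I_sub_one]; nth_rewrite 1 [← hβ]; push_cast; ring)
    (by
      have h1 : Complex.exp (θ * Complex.I) = Complex.exp (Complex.I * (θ / 2 : ℝ)) *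
          Complex.exp (-(Complex.I * β.arg)) * (Complex.exp (Complex.I * (θ / 2 : ℝ)) *
          Complex.exp (Complex.I * β.arg)) := by
        simp only [← Complex.exp_add]; congr 1; push_cast; ring
      rw [h1]
      linear_combination (Complex.exp (Complex.I * (θ / 2 : ℝ)) *
          Complex.exp (-(Complex.I * β.arg)) * (Complex.exp (Complex.I * (θ / 2 : ℝ)) *
          Complex.exp (Complex.I * β.arg))) * Complex.I_mul_I) a b
  have h2 : Complex.exp (Complex.I * ((θ / 2 * (a + b) + β.arg * (b - a) : ℝ) : ℂ))
      = (Complex.exp (Complex.I * (θ / 2 : ℝ)) * Complex.exp (-(Complex.I * β.arg))) ^ a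
        * (Complex.exp (Complex.I * (θ / 2 : ℝ)) * Complex.exp (Complex.I * β.arg)) ^ b := by
    simp only [← Complex.exp_add, ← Complex.exp_nat_mul]
    congr 1; push_cast; ring
  have h3 : aeval ((2 * ‖β‖ * Real.sin (θ / 2) : ℝ) : ℂ) (overlapPoly a b)
      = ((aeval (2 * ‖β‖ * Real.sin (θ / 2)) (overlapPoly a b) : ℝ) : ℂ) :=
    aeval_ofReal _ _
  rw [h, h2, h3, norm_neg, mul_pow, mul_pow]
  ring

/-- The polynomial governing the entry `(m₁, m₂), (m₃, m₄)` of the covariance matrix. -/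
noncomputable def covariancePoly (m₁ m₂ m₃ m₄ : ℕ) : ℤ[X] :=
  overlapPoly m₂ m₁ * overlapPoly m₃ m₄

lemma covariancePoly_monic (m₁ m₂ m₃ m₄ : ℕ) :
    (covariancePoly m₁ m₂ m₃ m₄).IsMonicOfDegree (m₁ + m₂ + m₃ + m₄) := by
  have h := (overlapPoly_monic m₂ m₁).mul (overlapPoly_monic m₃ m₄)
  rwa [show m₂ + m₁ + (m₃ + m₄) = m₁ + m₂ + m₃ + m₄ by ring] at h

lemma aeval_neg_overlapPoly_real (a b : ℕ) (y : ℝ) :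
    aeval (-y) (overlapPoly a b) = (-1) ^ (a + b) * aeval y (overlapPoly a b) := by
  have h := aeval_neg_overlapPoly a b y
  rw [← Complex.ofReal_neg, aeval_ofReal, aeval_ofReal] at h
  exact_mod_cast h

lemma aeval_neg_covariancePoly {m₁ m₂ m₃ m₄ : ℕ} (h : Odd (m₁ + m₂ + m₃ + m₄)) (y : ℝ) :
    aeval (-y) (covariancePoly m₁ m₂ m₃ m₄) = -aeval y (covariancePoly m₁ m₂ m₃ m₄) := by
  have h1 : (-1 : ℝ) ^ (m₂ + m₁) * (-1) ^ (m₃ + m₄) = -1 := by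
    rw [← pow_add, show m₂ + m₁ + (m₃ + m₄) = m₁ + m₂ + m₃ + m₄ by ring, h.neg_one_pow]
  simp only [covariancePoly, map_mul, aeval_neg_overlapPoly_real]
  linear_combination aeval y (overlapPoly m₂ m₁) * aeval y (overlapPoly m₃ m₄) * h1

/-- The phase and normalisation of the entry `(m₁, m₂), (m₃, m₄)` of the covariance matrix. -/
noncomputable def covariancePhase (m₁ m₂ m₃ m₄ : ℕ) (φ : ℝ) : ℂ :=
  (-Complex.I) ^ (m₂ + m₁) * (-Complex.I) ^ (m₃ + m₄) * (-1) ^ (m₃ + m₄)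
    * Complex.exp (Complex.I * ((φ * (m₁ - m₂ + (m₄ - m₃)) : ℝ) : ℂ))
    / (2 * Real.pi * (((Real.sqrt m₂.factorial : ℝ) : ℂ) * ((Real.sqrt m₁.factorial : ℝ) : ℂ)
      * (((Real.sqrt m₃.factorial : ℝ) : ℂ) * ((Real.sqrt m₄.factorial : ℝ) : ℂ))))

lemma covariancePhase_ne_zero (m₁ m₂ m₃ m₄ : ℕ) (φ : ℝ) : covariancePhase m₁ m₂ m₃ m₄ φ ≠ 0 := by
  simp [covariancePhase, Complex.exp_ne_zero, Nat.factorial_ne_zero, Real.pi_ne_zero]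

lemma covarianceMatrix_eq_tsum (β : ℂ) (m₁ m₂ m₃ m₄ : ℕ) :
    2 * Real.pi * covarianceMatrix β (m₁, m₂) (m₃, m₄)
      = ∫ θ in (-Real.pi)..Real.pi, overlapSeries (-β) (Complex.exp (θ * Complex.I)) m₂ m₁
          * overlapSeries (-β) (Complex.exp (-θ * Complex.I)) m₃ m₄ := by
  have h := integral_tsum_mul_tsum (summable_displacementCoeff_mul_conj (-β) m₂ m₁)
    (summable_displacementCoeff_mul_conj (-β) m₃ m₄)
  simp only [overlapSeries]
  rw [h, covarianceMatrix]
  congr 1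
  refine tsum_congr fun n => ?_
  simp only [sensingMatrix_eq, map_mul, Complex.conj_conj]
  ring

/-- The closed form is used at `θ` and at `-θ`. The exponents add up to `2‖β‖² (cos θ - 1) = -(2‖β‖
sin(θ/2))²`, the parity of the second polynomial yields `(-1) ^ (m₃ + m₄)`, and the half-angle
phases leave `e^{iDθ/2}`. -/
lemma covarianceMatrix_eq_angularIntegral (β : ℂ) (m₁ m₂ m₃ m₄ : ℕ) :
    covarianceMatrix β (m₁, m₂) (m₃, m₄) = covariancePhase m₁ m₂ m₃ m₄ β.arg
      * angularIntegral (covariancePoly m₁ m₂ m₃ m₄) (m₁ + m₂ - m₃ - m₄) ‖β‖ := by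
  have hpi : (2 * Real.pi : ℂ) ≠ 0 := by simp [Real.pi_ne_zero]
  have hS : (2 * Real.pi * (((Real.sqrt m₂.factorial : ℝ) : ℂ) * ((Real.sqrt m₁.factorial : ℝ) : ℂ)
      * (((Real.sqrt m₃.factorial : ℝ) : ℂ) * ((Real.sqrt m₄.factorial : ℝ) : ℂ)))) ≠ 0 :=
    mul_ne_zero hpi (by simp [Nat.factorial_ne_zero])
  rw [covariancePhase, div_mul_eq_mul_div, eq_div_iff hS, mul_comm, mul_right_comm,
    covarianceMatrix_eq_tsum, angularIntegral, mul_comm, ← intervalIntegral.integral_const_mul,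
    ← intervalIntegral.integral_const_mul]
  congr 1
  funext θ
  have h1 := sqrt_factorial_mul_overlapSeries_exp β θ m₂ m₁
  have h2 := sqrt_factorial_mul_overlapSeries_exp β (-θ) m₃ m₄
  have h3 : Complex.exp ((‖β‖ : ℂ) ^ 2 * (Complex.exp (θ * Complex.I) - 1))
      * Complex.exp ((‖β‖ : ℂ) ^ 2 * (Complex.exp ((-θ : ℝ) * Complex.I) - 1))
      = ((Real.exp (-(2 * ‖β‖ * Real.sin (θ / 2)) ^ 2) : ℝ) : ℂ) := by
    rw [← Complex.exp_add, Complex.ofReal_exp]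
    congr 1
    have e1 := Complex.exp_mul_I (θ : ℂ)
    have e2 := Complex.exp_mul_I ((-θ : ℝ) : ℂ)
    have e3 : Complex.cos (θ : ℂ) = 1 - 2 * ((Real.sin (θ / 2) : ℝ) : ℂ) ^ 2 := by
      have : Real.cos θ = 1 - 2 * Real.sin (θ / 2) ^ 2 := by
        rw [← Real.cos_two_mul_eq_one_sub, mul_div_cancel₀ _ two_ne_zero]
      rw [← Complex.ofReal_cos, this]; push_cast; rfl
    rw [e1, e2]
    simp only [Complex.ofReal_neg, Complex.cos_neg, Complex.sin_neg, e3]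
    push_cast
    ring
  have h4 : Complex.exp (Complex.I * ((θ / 2 * (m₂ + m₁) + β.arg * (m₁ - m₂) : ℝ) : ℂ))
      * Complex.exp (Complex.I * ((-θ / 2 * (m₃ + m₄) + β.arg * (m₄ - m₃) : ℝ) : ℂ))
      = Complex.exp (Complex.I * ((β.arg * (m₁ - m₂ + (m₄ - m₃)) : ℝ) : ℂ))
        * Complex.exp (Complex.I * (((m₁ + m₂ - m₃ - m₄) * θ / 2 : ℝ) : ℂ)) := by
    simp only [← Complex.exp_add]
    congr 1; push_cast; ring
  have h5 : (aeval (2 * ‖β‖ * Real.sin (-θ / 2)) (overlapPoly m₃ m₄) : ℝ)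
      = (-1) ^ (m₃ + m₄) * aeval (2 * ‖β‖ * Real.sin (θ / 2)) (overlapPoly m₃ m₄) := by
    rw [neg_div, Real.sin_neg, mul_neg, aeval_neg_overlapPoly_real]
  rw [h5] at h2
  have h6 := congrArg₂ (· * ·) h1 h2
  simp only [covariancePoly, map_mul]
  have h7 : Complex.exp (-θ * Complex.I) = Complex.exp ((-θ : ℝ) * Complex.I) := by push_cast; rfl
  have h8 : (((-1 : ℝ) ^ (m₃ + m₄) : ℝ) : ℂ) = (-1) ^ (m₃ + m₄) := by push_cast; rfl
  rw [Complex.ofReal_mul (Real.exp _), Complex.ofReal_mul (aeval _ _), ← h3, h7]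
  simp only [Complex.ofReal_mul ((-1 : ℝ) ^ _), h8] at h6
  linear_combination h6 + Complex.exp ((‖β‖ : ℂ) ^ 2 * (Complex.exp (θ * Complex.I) - 1))
      * Complex.exp ((‖β‖ : ℂ) ^ 2 * (Complex.exp ((-θ : ℝ) * Complex.I) - 1))
      * ((-Complex.I) ^ (m₂ + m₁) * (-Complex.I) ^ (m₃ + m₄) * (-1) ^ (m₃ + m₄))
      * ((aeval (2 * ‖β‖ * Real.sin (θ / 2)) (overlapPoly m₂ m₁) : ℝ) : ℂ)
      * ((aeval (2 * ‖β‖ * Real.sin (θ / 2)) (overlapPoly m₃ m₄) : ℝ) : ℂ) * h4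

/-- The limit of `‖β‖` (even case) or `‖β‖²` (odd case) times the angular integral. -/
noncomputable def covarianceLimit (m₁ m₂ m₃ m₄ : ℕ) : ℂ :=
  if Even (m₁ + m₂ + m₃ + m₄) then
    ((∫ x : ℝ, Real.exp (-x ^ 2) * aeval x (covariancePoly m₁ m₂ m₃ m₄) : ℝ) : ℂ)
  else
    Complex.I * (((m₁ + m₂ - m₃ - m₄ : ℝ) / 2 : ℝ) : ℂ) *
      ((∫ x : ℝ, Real.exp (-x ^ 2) * aeval x (X * covariancePoly m₁ m₂ m₃ m₄) : ℝ) : ℂ)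

lemma covarianceLimit_ne_zero (m₁ m₂ m₃ m₄ : ℕ) : covarianceLimit m₁ m₂ m₃ m₄ ≠ 0 := by
  have hP := covariancePoly_monic m₁ m₂ m₃ m₄
  rw [covarianceLimit]
  split_ifs with h
  · obtain ⟨M, hM⟩ := h
    rw [hM, ← two_mul] at hP
    exact Complex.ofReal_ne_zero.mpr (integral_exp_neg_sq_mul_aeval_ne_zero hP)
  · rw [Nat.not_even_iff_odd] at h
    -- The difference has the parity of the sum `m₁ + m₂ + m₃ + m₄`, which is odd.
    have hD : ((m₁ + m₂ - m₃ - m₄ : ℝ) / 2 : ℝ) ≠ 0 := by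
      refine div_ne_zero (fun h0 => ?_) two_ne_zero
      have h1 : m₁ + m₂ = m₃ + m₄ := by
        have : (m₁ + m₂ : ℝ) = m₃ + m₄ := by linarith
        exact_mod_cast this
      obtain ⟨M, hM⟩ := h
      omega
    obtain ⟨M, hM⟩ := h
    have hX := (isMonicOfDegree_X ℤ).mul hP
    rw [hM, show 1 + (2 * M + 1) = 2 * (M + 1) by ring] at hX
    exact mul_ne_zero (mul_ne_zero Complex.I_ne_zero (Complex.ofReal_ne_zero.mpr hD))
      (Complex.ofReal_ne_zero.mpr (integral_exp_neg_sq_mul_aeval_ne_zero hX))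

/-- The factor `κ β.arg` cancels in the quotient of the two sides, which depends on `‖β‖` alone;
hence the uniformity in the argument. -/
lemma isEquivalent_of_tendsto_pow_mul {C : ℂ → ℂ} {κ : ℝ → ℂ} {I : ℝ → ℂ} {J : ℂ} {p : ℕ}
    (hC : ∀ β, C β = κ β.arg * I ‖β‖) (hκ : ∀ φ, κ φ ≠ 0) (hJ : J ≠ 0)
    (hI : Tendsto (fun r : ℝ => (r : ℂ) ^ p * I r) atTop (𝓝 J)) :
    C ~[Bornology.cobounded ℂ] fun β => κ β.arg * J / (‖β‖ : ℂ) ^ p := by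
  have hne : ∀ᶠ β : ℂ in Bornology.cobounded ℂ, (‖β‖ : ℂ) ≠ 0 :=
    ((tendsto_norm_cobounded_atTop (E := ℂ)).eventually_gt_atTop 0).mono fun β hβ =>
      Complex.ofReal_ne_zero.mpr hβ.ne'
  rw [Asymptotics.isEquivalent_iff_tendsto_one (hne.mono fun β hβ =>
    div_ne_zero (mul_ne_zero (hκ _) hJ) (pow_ne_zero _ hβ))]
  have h := (hI.comp (tendsto_norm_cobounded_atTop (E := ℂ))).div_const J
  rw [div_self hJ] at h
  refine h.congr' (hne.mono fun β hβ => ?_)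
  have := hκ β.arg
  simp only [Function.comp_apply, Pi.div_apply, hC]
  field_simp

end FockTomography

theorem theorem1 :
    ∃ g : ℕ → ℕ → ℕ → ℕ → ℝ → ℂ,
      ∀ m₁ m₂ m₃ m₄ : ℕ,
        (∀ φ : ℝ, g m₁ m₂ m₃ m₄ φ ≠ 0) ∧
        (Even (m₁ + m₂ + m₃ + m₄) →
          (fun β : ℂ => FockTomography.covarianceMatrix β (m₁, m₂) (m₃, m₄))
            ~[Bornology.cobounded ℂ]
          (fun β : ℂ => g m₁ m₂ m₃ m₄ (Complex.arg β) / (‖β‖ : ℂ))) ∧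
        (Odd (m₁ + m₂ + m₃ + m₄) →
          (fun β : ℂ => FockTomography.covarianceMatrix β (m₁, m₂) (m₃, m₄))
            ~[Bornology.cobounded ℂ]
          (fun β : ℂ => g m₁ m₂ m₃ m₄ (Complex.arg β) / (‖β‖ : ℂ) ^ 2)) := by
  refine ⟨fun m₁ m₂ m₃ m₄ φ => FockTomography.covariancePhase m₁ m₂ m₃ m₄ φ
    * FockTomography.covarianceLimit m₁ m₂ m₃ m₄, fun m₁ m₂ m₃ m₄ => ⟨fun φ => ?_, fun h => ?_,
    fun h => ?_⟩⟩
  · exact mul_ne_zero (FockTomography.covariancePhase_ne_zero m₁ m₂ m₃ m₄ φ)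
      (FockTomography.covarianceLimit_ne_zero m₁ m₂ m₃ m₄)
  · have hlim := FockTomography.tendsto_mul_angularIntegral
      (FockTomography.covariancePoly m₁ m₂ m₃ m₄) (m₁ + m₂ - m₃ - m₄)
    have h1 := FockTomography.isEquivalent_of_tendsto_pow_mul (p := 1)
      (fun β => FockTomography.covarianceMatrix_eq_angularIntegral β m₁ m₂ m₃ m₄)
      (FockTomography.covariancePhase_ne_zero m₁ m₂ m₃ m₄)
      (FockTomography.covarianceLimit_ne_zero m₁ m₂ m₃ m₄)
      (by simpa only [pow_one, FockTomography.covarianceLimit, if_pos h] using hlim)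
    simpa only [pow_one] using h1
  · have hlim := FockTomography.tendsto_sq_mul_angularIntegral
      (FockTomography.aeval_neg_covariancePoly h) (m₁ + m₂ - m₃ - m₄)
    exact FockTomography.isEquivalent_of_tendsto_pow_mul (p := 2)
      (fun β => FockTomography.covarianceMatrix_eq_angularIntegral β m₁ m₂ m₃ m₄)
      (FockTomography.covariancePhase_ne_zero m₁ m₂ m₃ m₄)
      (FockTomography.covarianceLimit_ne_zero m₁ m₂ m₃ m₄)
      (by simpa only [FockTomography.covarianceLimit, if_neg (Nat.not_even_iff_odd.mpr h)]
        using hlim)
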